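/- Let $h:[0,1]^2\to[0,\infty)$ be continuous with $h(u,u)=0$ for all $u\in[0,1]$, and let $F:\mathbb R\to[0,1]$ be a cumulative distribution function. Let $(X,Y)$ be a pair of real random variables, neither of which is almost surely constant, and let $(X_1,Y_1),(X_2,Y_2),\dots$ be i.i.d. copies of $(X,Y)$. For each $n$ let $(X_{(1)},Y_{[1]}),\dots,(X_{(n)},Y_{[n]})$ be the first $n$ pairs rearranged so that $X_{(1)}\le\dots\le X_{(n)}$, with ties broken uniformly at random (that is, conditionally on the first $n$ pairs, the rearranging permutation is uniformly distributed on all permutations that sort $X_1,\dots,X_n$). Put $$\zeta_n=\frac1n\sum_{i=1}^{n-1}h\big(F(Y_{[i]}),F(Y_{[i+1]})\big),\qquad \chi_n=\frac1{n^2}\sum_{i=1}^n\sum_{j=1}^n h\big(F(Y_i),F(Y_j)\big),$$ and $\xi_n^{(h,F)}=1-\zeta_n/\chi_n$, with $\xi_n^{(h,F)}=1$ if $\chi_n=0$. Let $\mu_X,\mu_Y$ be the laws of $X,Y$ and $\mu_{Y|x}$ a regular conditional law of $Y$ given $X=x$. Then, as $n\to\infty$: (i) $\zeta_n\to\zeta:=\int\int\int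 h(F(y),F(z))\,d\mu_{Y|x}(y)\,d\mu_{Y|x}(z)\,d\mu_X(x)$ almost surely; (ii) $\chi_n\to\chi:=\int\int h(F(y),F(z))\,d\mu_Y(y)\,d\mu_Y(z)$ almost surely; (iii) $\xi_n^{(h,F)}\to\xi^{(h,F)}$ almost surely, where $\xi^{(h,F)}:=1-\zeta/\chi$ if $\chi\neq0$ and $\xi^{(h,F)}:=1$ if $\chi=0$. -/

import Mathlib

open MeasureTheory ProbabilityTheory Filter Topology

namespace CorrCoef

noncomputable section

/-- `F : ℝ → [0,1]` is the cumulative distribution function of some probability law on `ℝ`. -/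
def IsCDF (F : ℝ → unitInterval) : Prop :=
  ∃ ν : Measure ℝ, IsProbabilityMeasure ν ∧ ∀ t, (F t : ℝ) = cdf ν t

open Classical in
/-- The orderings of the sample that sort `x`: the permutations `σ` for which
`x (σ 0) ≤ x (σ 1) ≤ … ≤ x (σ (n - 1))`. There are several of them when `x` has ties. -/
def sortingPerms {n : ℕ} (x : Fin n → ℝ) : Finset (Equiv.Perm (Fin n)) :=
  Finset.univ.filter fun σ => Monotone fun i => x (σ i)

open Classical in
/-- `π` is a random ordering of the sample `(x₀, y₀), …, (xₙ₋₁, yₙ₋₁)` by increasing `x`, with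
ties broken uniformly at random: given the sample, `π` is uniformly distributed on the orderings
that sort `x`. -/
structure IsUniformOrdering {Ω : Type*} [MeasurableSpace Ω] (P : Measure Ω) {n : ℕ}
    (x y : Fin n → Ω → ℝ) (π : Ω → Equiv.Perm (Fin n)) : Prop where
  measurableSet_eq : ∀ σ, MeasurableSet {ω | π ω = σ}
  condProb_eq : ∀ σ,
    P[Set.indicator {ω | π ω = σ} (fun _ => (1 : ℝ)) |
        MeasurableSpace.comap (fun ω (i : Fin n) => (x i ω, y i ω)) inferInstance]
      =ᵐ[P] fun ω =>
        if σ ∈ sortingPerms (fun i => x i ω) then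
          1 / ((sortingPerms fun i => x i ω).card : ℝ)
        else 0

/-- The variation statistic `ζₙ = n⁻¹ ∑ᵢ h (F Y_[i]) (F Y_[i+1])`, a sum over the `n - 1` pairs of
consecutive sample points in the ordering `σ`; `y (σ i)` is the concomitant `Y_[i]`. -/
def variationStat (h : unitInterval → unitInterval → ℝ) (F : ℝ → unitInterval) {n : ℕ}
    (y : Fin n → ℝ) (σ : Equiv.Perm (Fin n)) : ℝ :=
  1 / (n : ℝ) * ∑ i : Fin (n - 1),
    h (F (y (σ ⟨i.1, by have := i.2; omega⟩))) (F (y (σ ⟨i.1 + 1, by have := i.2; omega⟩)))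

/-- The normalization statistic `χₙ = n⁻² ∑ᵢ ∑ⱼ h (F Yᵢ) (F Yⱼ)`. -/
def normStat (h : unitInterval → unitInterval → ℝ) (F : ℝ → unitInterval) {n : ℕ}
    (y : Fin n → ℝ) : ℝ :=
  1 / (n : ℝ) ^ 2 * ∑ i : Fin n, ∑ j : Fin n, h (F (y i)) (F (y j))

open Classical in
/-- The correlation coefficient `ξₙ = 1 - ζₙ / χₙ`, set to `1` when `χₙ = 0`. -/
def corrCoef (h : unitInterval → unitInterval → ℝ) (F : ℝ → unitInterval) {n : ℕ}
    (y : Fin n → ℝ) (σ : Equiv.Perm (Fin n)) : ℝ :=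
  if normStat h F y = 0 then 1 else 1 - variationStat h F y σ / normStat h F y

/-- The limit `ζ = ∫∫∫ h (F y) (F z) dμ_{Y|x}(y) dμ_{Y|x}(z) dμ_X(x)`. -/
def variationLimit (h : unitInterval → unitInterval → ℝ) (F : ℝ → unitInterval)
    {Ω : Type*} [MeasurableSpace Ω] (P : Measure Ω) [IsFiniteMeasure P] (X Y : Ω → ℝ) : ℝ :=
  ∫ x, ∫ z, ∫ y, h (F y) (F z) ∂(condDistrib Y X P x) ∂(condDistrib Y X P x) ∂(P.map X)

/-- The limit `χ = ∫∫ h (F y) (F z) dμ_Y(y) dμ_Y(z)`. -/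
def normLimit (h : unitInterval → unitInterval → ℝ) (F : ℝ → unitInterval)
    {Ω : Type*} [MeasurableSpace Ω] (P : Measure Ω) (Y : Ω → ℝ) : ℝ :=
  ∫ z, ∫ y, h (F y) (F z) ∂(P.map Y) ∂(P.map Y)

open Classical in
/-- The correlation measure `ξ = 1 - ζ / χ`, set to `1` when `χ = 0`. -/
def corrMeasure (h : unitInterval → unitInterval → ℝ) (F : ℝ → unitInterval)
    {Ω : Type*} [MeasurableSpace Ω] (P : Measure Ω) [IsFiniteMeasure P] (X Y : Ω → ℝ) : ℝ :=
  if normLimit h F P Y = 0 then 1 else 1 - variationLimit h F P X Y / normLimit h F P Y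

end

end CorrCoef

/-!
The kernel `h (F y) (F z)` is first replaced by a product `f y * g z` of bounded measurable
functions. Discretising the first variable approximates `h` uniformly by finite sums of such
products (`exists_sum_mul_approx`), and both statistics are averages of `h` over pairs of sample
points, hence linear and nonexpansive in `h`, so that almost sure convergence passes to the limit
(`ae_tendsto_of_mul`). For products, `normStat` is a product of two sample means and the strong law
of large numbers applies (`IsIIDSample.ae_tendsto_normStat`).

For `variationStat`, write `f'(x)` and `g'(x)` for the conditional expectations of `f(Y)` and
`g(Y)` given `X = x`, and `(X₍ᵢ₎, Y₍ᵢ₎)` for the reordered sample. Then `f(Y₍ᵢ₎) g(Y₍ᵢ₊₁₎)` is the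
sum of
* `(f(Y₍ᵢ₎) - f'(X₍ᵢ₎)) g(Y₍ᵢ₊₁₎)` and `f'(X₍ᵢ₎) (g(Y₍ᵢ₊₁₎) - g'(X₍ᵢ₊₁₎))`. Since the ordering has
  a conditional law given the sample that depends on the `X`-values only, these are martingale
  differences for every fixed ordering, even after weighting by the conditional probability of
  that ordering. Peeling them off one at a time bounds the exponential moments
  (`integral_mul_exp_sum_le`); summing over the orderings gives an exponential tail bound
  (`measureReal_le_abs_sum_le`), and the Borel-Cantelli lemma shows that the averages vanish almost
  surely (`ae_tendsto_centred_sum_div`). No joint law of the orderings for different `n` is needed.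
* `f'(X₍ᵢ₎) (g'(X₍ᵢ₊₁₎) - g'(X₍ᵢ₎))`. If `g'` has bounded variation, the sum over `i` stays bounded
  because the `X₍ᵢ₎` are sorted. In general `g'` is approximated in `L¹` by such functions, the
  error being controlled by the strong law (`IsIIDSample.ae_tendsto_sum_abs_sub`).
* `f'(X₍ᵢ₎) g'(X₍ᵢ₎)`, whose average does not depend on the ordering, up to the last term, and
  converges by the strong law (`IsIIDSample.ae_tendsto_variation_mul`).

For the coefficient itself, the only case not covered by continuity of division is a vanishing
limit of `normStat`; there `normStat` is almost surely zero for every `n`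
(`IsIIDSample.ae_normStat_eq_zero`), and both the coefficient and its limit are `1`.
-/

namespace CorrCoef

/-! ### Exponential moments of centred sums on a product space -/

section Concentration

variable {α β : Type*} [MeasurableSpace α] [MeasurableSpace β]

lemma integrable_of_abs_le {Ω : Type*} [MeasurableSpace Ω] {P : Measure Ω} [IsFiniteMeasure P]
    {f : Ω → ℝ} (hf : Measurable f) {C : ℝ} (hC : ∀ ω, |f ω| ≤ C) : Integrable f P :=
  Integrable.of_bound hf.aestronglyMeasurable C (ae_of_all _ hC)

/-- A function `a` of the `j`-th pair which is centred given the first component of that pair is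
orthogonal to every `W` that does not see the second component of the `j`-th pair. -/
lemma integral_pi_mul_eq_zero {n : ℕ} (μ : Measure α) [IsProbabilityMeasure μ] (κ : Kernel α β)
    [IsMarkovKernel κ] (j : Fin n) {a : α × β → ℝ} (ha : Measurable a) {A : ℝ}
    (haA : ∀ q, |a q| ≤ A) (ha0 : ∀ x, ∫ y, a (x, y) ∂κ x = 0)
    {W : (Fin n → α × β) → ℝ} (hW : Measurable W) {B : ℝ} (hWB : ∀ z, |W z| ≤ B)
    (hWj : ∀ z z', (∀ i, i ≠ j → z i = z' i) → (z j).1 = (z' j).1 → W z = W z') :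
    ∫ z, W z * a (z j) ∂Measure.pi (fun _ : Fin n => μ ⊗ₘ κ) = 0 := by
  obtain ⟨m, rfl⟩ : ∃ m, n = m + 1 := ⟨n - 1, by have := j.2; omega⟩
  have key := (measurePreserving_piFinSuccAbove (fun _ : Fin (m + 1) => μ ⊗ₘ κ) j).symm
  rw [← key.integral_comp' (g := fun z => W z * a (z j))]
  have hmeas : Measurable fun p : (α × β) × (Fin m → α × β) =>
      W ((MeasurableEquiv.piFinSuccAbove (fun _ => α × β) j).symm p) *
        a ((MeasurableEquiv.piFinSuccAbove (fun _ => α × β) j).symm p j) := by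
    have h1 := (MeasurableEquiv.piFinSuccAbove (fun _ : Fin (m + 1) => α × β) j).symm.measurable
    exact (hW.comp h1).mul (ha.comp ((measurable_pi_apply j).comp h1))
  have hbound : ∀ z, |W z * a (z j)| ≤ B * A := fun z => by
    rw [abs_mul]
    exact mul_le_mul (hWB _) (haA _) (abs_nonneg _) ((abs_nonneg _).trans (hWB z))
  rw [integral_prod_symm _ (integrable_of_abs_le hmeas fun p => hbound _)]
  refine integral_eq_zero_of_ae (ae_of_all _ fun r => ?_)
  have hmeas' := hmeas.comp (measurable_prodMk_right (y := r) : Measurable fun p : α × β => (p, r))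
  refine (Measure.integral_compProd (integrable_of_abs_le hmeas' fun p => hbound _)).trans ?_
  refine integral_eq_zero_of_ae (ae_of_all _ fun x => ?_)
  obtain ⟨y₀⟩ : Nonempty β := (κ x).nonempty_of_neZero
  have : ∀ y, W ((MeasurableEquiv.piFinSuccAbove (fun _ => α × β) j).symm ((x, y), r)) *
        a ((MeasurableEquiv.piFinSuccAbove (fun _ => α × β) j).symm ((x, y), r) j) =
      W ((MeasurableEquiv.piFinSuccAbove (fun _ => α × β) j).symm ((x, y₀), r)) * a (x, y) := by
    intro y
    have he : ∀ q i, (MeasurableEquiv.piFinSuccAbove (fun _ => α × β) j).symm q i =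
        Fin.insertNth (α := fun _ => α × β) j q.1 q.2 i := fun _ _ => rfl
    congr 1
    · refine hWj _ _ (fun i hi => ?_) ?_
      · obtain ⟨k, rfl⟩ := Fin.exists_succAbove_eq hi
        simp [he]
      · simp [he]
    · simp [he]
  simp only [Function.comp_apply, this, integral_const_mul, ha0, mul_zero, Pi.zero_apply]

lemma exp_le_one_add_add_sq {x : ℝ} (hx : |x| ≤ 1) : Real.exp x ≤ 1 + x + x ^ 2 := by
  have := (abs_le.1 (Real.abs_exp_sub_one_sub_id_le hx)).2
  linarith

/-- Exponential moment bound for a sum of terms `a (z (p i)) * v i z`, where `a` is centred given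
the first component of its argument, and `v i` ignores the second components at the positions
`p k`, `k ≤ i`. These terms are martingale differences when taken in decreasing order of `i`, and
the weight `w` may depend on all the first components. -/
lemma integral_mul_exp_sum_le {m n : ℕ} (μ : Measure α) [IsProbabilityMeasure μ] (κ : Kernel α β)
    [IsMarkovKernel κ] {p : Fin m → Fin n} (hp : Function.Injective p)
    {a : α × β → ℝ} (ha : Measurable a) {A : ℝ}
    (haA : ∀ q, |a q| ≤ A) (ha0 : ∀ x, ∫ y, a (x, y) ∂κ x = 0)
    {w : (Fin n → α × β) → ℝ} (hw : Measurable w) (hw0 : ∀ z, 0 ≤ w z) (hw1 : ∀ z, w z ≤ 1)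
    (hwx : ∀ z z', (∀ i, (z i).1 = (z' i).1) → w z = w z')
    {v : Fin m → (Fin n → α × β) → ℝ} (hv : ∀ i, Measurable (v i)) {B : ℝ}
    (hvB : ∀ i z, |v i z| ≤ B)
    (hvp : ∀ i k, k ≤ i → ∀ z z', (∀ l, l ≠ p k → z l = z' l) → (z (p k)).1 = (z' (p k)).1 →
      v i z = v i z')
    {t : ℝ} (ht : |t| * (A * B) ≤ 1) :
    ∫ z, w z * Real.exp (t * ∑ i, a (z (p i)) * v i z) ∂Measure.pi (fun _ : Fin n => μ ⊗ₘ κ) ≤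
      (1 + (t * (A * B)) ^ 2) ^ m * ∫ z, w z ∂Measure.pi (fun _ : Fin n => μ ⊗ₘ κ) := by
  set Q := Measure.pi (fun _ : Fin n => μ ⊗ₘ κ)
  set c := 1 + (t * (A * B)) ^ 2
  have hd : ∀ i z, |t * (a (z (p i)) * v i z)| ≤ |t| * (A * B) := fun i z => by
    rw [abs_mul, abs_mul]
    exact mul_le_mul_of_nonneg_left (mul_le_mul (haA _) (hvB _ _) (abs_nonneg _)
      ((abs_nonneg _).trans (haA (z (p i))))) (abs_nonneg _)
  have hdm : ∀ i, Measurable fun z : Fin n → α × β => a (z (p i)) * v i z := fun i =>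
    (ha.comp (measurable_pi_apply _)).mul (hv i)
  suffices H : ∀ s : Finset (Fin m),
      ∫ z, w z * Real.exp (t * ∑ i ∈ s, a (z (p i)) * v i z) ∂Q ≤ c ^ s.card * ∫ z, w z ∂Q by
    simpa using H Finset.univ
  intro s
  -- Every term with index above `j` ignores the second component at `p j`, so the smallest index is
  -- the one to remove.
  induction s using Finset.induction_on_min with
  | empty => simp
  | insert j s hj ih =>
    have hjs : j ∉ s := fun h => lt_irrefl _ (hj j h)
    set W : (Fin n → α × β) → ℝ := fun z => w z * Real.exp (t * ∑ i ∈ s, a (z (p i)) * v i z)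
      with hWdef
    have hWm : Measurable W := by
      refine hw.mul (Real.measurable_exp.comp (Measurable.const_mul ?_ _))
      exact Finset.measurable_sum _ fun i _ => hdm i
    have hW0 : ∀ z, 0 ≤ W z := fun z => mul_nonneg (hw0 z) (Real.exp_pos _).le
    have hWb : ∀ z, |W z| ≤ Real.exp (s.card * (|t| * (A * B))) := fun z => by
      rw [abs_of_nonneg (hW0 z)]
      refine (mul_le_of_le_one_left (Real.exp_pos _).le (hw1 z)).trans (Real.exp_le_exp.2 ?_)
      rw [Finset.mul_sum, ← nsmul_eq_mul]
      exact Finset.sum_le_card_nsmul _ _ _ fun i _ => (le_abs_self _).trans (hd i z)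
    have hWj : ∀ z z', (∀ i, i ≠ p j → z i = z' i) → (z (p j)).1 = (z' (p j)).1 → W z = W z' := by
      intro z z' h1 h2
      simp only [hWdef]
      congr 1
      · refine hwx _ _ fun i => ?_
        by_cases hi : i = p j
        · rw [hi, h2]
        · rw [h1 i hi]
      · congr 2
        refine Finset.sum_congr rfl fun i hi => ?_
        rw [hvp i j (hj i hi).le z z' h1 h2, h1 (p i) (fun h => (hj i hi).ne' (hp h))]
    have hWv : ∀ z, |W z * v j z| ≤ Real.exp (s.card * (|t| * (A * B))) * B := fun z => by
      rw [abs_mul]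
      exact mul_le_mul (hWb z) (hvB _ _) (abs_nonneg _) (Real.exp_pos _).le
    have hzero : ∫ z, (W z * v j z) * a (z (p j)) ∂Q = 0 := by
      refine integral_pi_mul_eq_zero μ κ (p j) ha haA ha0 (hWm.mul (hv j)) hWv ?_
      intro z z' h1 h2
      rw [hWj z z' h1 h2, hvp j j le_rfl z z' h1 h2]
    have hI1 : Integrable W Q := integrable_of_abs_le hWm hWb
    have hI2 : Integrable (fun z => (W z * v j z) * a (z (p j))) Q := by
      refine integrable_of_abs_le (C := Real.exp (s.card * (|t| * (A * B))) * B * A)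
        ((hWm.mul (hv j)).mul (ha.comp (measurable_pi_apply _))) fun z => ?_
      rw [abs_mul]
      exact mul_le_mul (hWv z) (haA _) (abs_nonneg _) ((abs_nonneg _).trans (hWv z))
    calc ∫ z, w z * Real.exp (t * ∑ i ∈ insert j s, a (z (p i)) * v i z) ∂Q
        ≤ ∫ z, (c * W z + t * ((W z * v j z) * a (z (p j)))) ∂Q := by
          refine integral_mono_of_nonneg (ae_of_all _ fun z => mul_nonneg (hw0 z)
            (Real.exp_pos _).le) ((hI1.const_mul _).add (hI2.const_mul _)) (ae_of_all _ fun z => ?_)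
          have h1 := exp_le_one_add_add_sq ((hd j z).trans ht)
          have h2 : (t * (a (z (p j)) * v j z)) ^ 2 ≤ (t * (A * B)) ^ 2 := by
            rw [← sq_abs, mul_pow, ← sq_abs t, ← mul_pow]
            exact pow_le_pow_left₀ (abs_nonneg _) (hd j z) 2
          have h3 : Real.exp (t * ∑ i ∈ insert j s, a (z (p i)) * v i z) =
              Real.exp (t * ∑ i ∈ s, a (z (p i)) * v i z) *
                Real.exp (t * (a (z (p j)) * v j z)) := by
            rw [Finset.sum_insert hjs, mul_add, Real.exp_add, mul_comm]
          simp only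
          rw [h3, ← mul_assoc]
          refine (mul_le_mul_of_nonneg_left (h1.trans (add_le_add_right h2 _)) (hW0 z)).trans
            (le_of_eq ?_)
          ring
      _ = c * ∫ z, W z ∂Q := by
          rw [integral_add (hI1.const_mul _) (hI2.const_mul _), integral_const_mul,
            integral_const_mul, hzero, mul_zero, add_zero]
      _ ≤ c * (c ^ s.card * ∫ z, w z ∂Q) :=
          mul_le_mul_of_nonneg_left ih (by positivity)
      _ = c ^ (insert j s).card * ∫ z, w z ∂Q := by
          rw [Finset.card_insert_of_notMem hjs]; ring

end Concentration

/-! ### Uniform orderings -/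

section UniformOrdering

/-- The conditional probability, given a sample with first components `x`, that the uniform
ordering equals `σ`. -/
noncomputable def orderingWeight {n : ℕ} (σ : Equiv.Perm (Fin n)) (x : Fin n → ℝ) : ℝ :=
  open Classical in if σ ∈ sortingPerms x then 1 / ((sortingPerms x).card : ℝ) else 0

lemma orderingWeight_nonneg {n : ℕ} (σ : Equiv.Perm (Fin n)) (x : Fin n → ℝ) :
    0 ≤ orderingWeight σ x := by
  unfold orderingWeight; split_ifs <;> positivity

lemma orderingWeight_le_one {n : ℕ} (σ : Equiv.Perm (Fin n)) (x : Fin n → ℝ) :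
    orderingWeight σ x ≤ 1 := by
  unfold orderingWeight
  split_ifs with h
  · have : 0 < (sortingPerms x).card := Finset.card_pos.2 ⟨σ, h⟩
    exact div_le_one_of_le₀ (by exact_mod_cast this) (by positivity)
  · exact zero_le_one

lemma mem_sortingPerms {n : ℕ} {σ : Equiv.Perm (Fin n)} {x : Fin n → ℝ} :
    σ ∈ sortingPerms x ↔ Monotone fun i => x (σ i) := by
  simp [sortingPerms]

lemma measurableSet_mem_sortingPerms {n : ℕ} (σ : Equiv.Perm (Fin n)) :
    MeasurableSet {x : Fin n → ℝ | σ ∈ sortingPerms x} := by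
  have : {x : Fin n → ℝ | σ ∈ sortingPerms x} =
      ⋂ i, ⋂ j, ⋂ (_ : i ≤ j), {x : Fin n → ℝ | x (σ i) ≤ x (σ j)} := by
    ext x
    simp [mem_sortingPerms, Monotone]
  rw [this]
  exact MeasurableSet.iInter fun i => MeasurableSet.iInter fun j => MeasurableSet.iInter fun _ =>
    measurableSet_le (measurable_pi_apply _) (measurable_pi_apply _)

lemma measurable_orderingWeight {n : ℕ} (σ : Equiv.Perm (Fin n)) :
    Measurable (orderingWeight σ) := by
  classical
  have hcard : Measurable fun x : Fin n → ℝ => ((sortingPerms x).card : ℝ) := by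
    have : (fun x : Fin n → ℝ => ((sortingPerms x).card : ℝ)) =
        fun x => ∑ τ : Equiv.Perm (Fin n), if τ ∈ sortingPerms x then (1 : ℝ) else 0 := by
      ext x; simp
    rw [this]
    exact Finset.measurable_sum _ fun τ _ =>
      Measurable.ite (measurableSet_mem_sortingPerms τ) measurable_const measurable_const
  exact Measurable.ite (measurableSet_mem_sortingPerms σ) (measurable_const.div hcard)
    measurable_const

variable {Ω : Type*} [MeasurableSpace Ω] {P : Measure Ω} [IsProbabilityMeasure P] {n : ℕ}
  {x y : Fin n → Ω → ℝ} {π : Ω → Equiv.Perm (Fin n)}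

lemma measurable_sample (hx : ∀ i, Measurable (x i)) (hy : ∀ i, Measurable (y i)) :
    Measurable fun ω (i : Fin n) => (x i ω, y i ω) :=
  measurable_pi_lambda _ fun i => (hx i).prodMk (hy i)

/-- Integrating a function of the sample over `{π = σ}` amounts to weighting it with the
conditional probability of `{π = σ}`. -/
lemma IsUniformOrdering.integral_indicator_mul (hπ : IsUniformOrdering P x y π)
    (hx : ∀ i, Measurable (x i)) (hy : ∀ i, Measurable (y i)) (σ : Equiv.Perm (Fin n))
    {G : (Fin n → ℝ × ℝ) → ℝ} (hG : Measurable G) {C : ℝ} (hC : ∀ z, |G z| ≤ C) :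
    ∫ ω, {ω | π ω = σ}.indicator (fun _ => (1 : ℝ)) ω * G (fun i => (x i ω, y i ω)) ∂P =
      ∫ ω, orderingWeight σ (fun i => x i ω) * G (fun i => (x i ω, y i ω)) ∂P := by
  have hm := (measurable_sample hx hy).comap_le
  have hI : Integrable ({ω | π ω = σ}.indicator (fun _ => (1 : ℝ))) P :=
    (integrable_const _).indicator (hπ.measurableSet_eq σ)
  have h1 := condExp_stronglyMeasurable_mul_of_bound hm
    (f := fun ω => G (fun i => (x i ω, y i ω)))
    (hG.comp (comap_measurable _)).stronglyMeasurable hI C (ae_of_all _ fun ω => hC _)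
  rw [← integral_condExp hm]
  refine integral_congr_ae ?_
  have h2 : (fun ω => {ω | π ω = σ}.indicator (fun _ => (1 : ℝ)) ω *
      G (fun i => (x i ω, y i ω))) = (fun ω => G (fun i => (x i ω, y i ω))) *
        {ω | π ω = σ}.indicator (fun _ => (1 : ℝ)) := by
    ext ω; simp [mul_comm]
  rw [h2]
  filter_upwards [h1, hπ.condProb_eq σ] with ω hω1 hω2
  rw [hω1, Pi.mul_apply, hω2, mul_comm]
  rfl

/-- A uniform ordering almost surely sorts the sample: its conditional law charges no other
permutation. -/
lemma IsUniformOrdering.ae_mem_sortingPerms (hπ : IsUniformOrdering P x y π)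
    (hx : ∀ i, Measurable (x i)) (hy : ∀ i, Measurable (y i)) :
    ∀ᵐ ω ∂P, π ω ∈ sortingPerms (fun i => x i ω) := by
  classical
  have H : ∀ σ, ∀ᵐ ω ∂P, π ω = σ → σ ∈ sortingPerms (fun i => x i ω) := by
    intro σ
    have hfst : Measurable fun (z : Fin n → ℝ × ℝ) (i : Fin n) => (z i).1 := by fun_prop
    have hS : MeasurableSet {z : Fin n → ℝ × ℝ | σ ∈ sortingPerms fun i => (z i).1}ᶜ :=
      (hfst (measurableSet_mem_sortingPerms σ)).compl
    set G : (Fin n → ℝ × ℝ) → ℝ :=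
      {z : Fin n → ℝ × ℝ | σ ∈ sortingPerms fun i => (z i).1}ᶜ.indicator fun _ => 1 with hGdef
    have hG : Measurable G := measurable_const.indicator hS
    have hG0 : ∀ z, 0 ≤ G z := fun z => Set.indicator_nonneg (fun _ _ => zero_le_one) z
    have hG1 : ∀ z, G z ≤ 1 := fun z => Set.indicator_le_self' (fun _ _ => zero_le_one) z
    have h := hπ.integral_indicator_mul hx hy σ hG (C := 1)
      fun z => by rw [abs_of_nonneg (hG0 z)]; exact hG1 z
    have hz : ∀ ω, orderingWeight σ (fun i => x i ω) * G (fun i => (x i ω, y i ω)) = 0 := by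
      intro ω
      by_cases hσ : σ ∈ sortingPerms (fun i => x i ω) <;> simp [orderingWeight, hGdef, hσ]
    simp only [hz, integral_zero] at h
    have h0 : ∀ ω, 0 ≤ {ω | π ω = σ}.indicator (fun _ => (1 : ℝ)) ω *
        G (fun i => (x i ω, y i ω)) :=
      fun ω => mul_nonneg (Set.indicator_nonneg (fun _ _ => zero_le_one) ω) (hG0 _)
    rw [integral_eq_zero_iff_of_nonneg h0] at h
    · filter_upwards [h] with ω hω hπω
      by_contra hσ
      simp [hGdef, hπω, hσ] at hω
    · refine integrable_of_abs_le (C := 1) ((measurable_const.indicator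
        (hπ.measurableSet_eq σ)).mul (hG.comp (measurable_sample hx hy))) fun ω => ?_
      rw [abs_of_nonneg (h0 ω)]
      exact mul_le_one₀ (Set.indicator_le_self' (fun _ _ => zero_le_one) ω) (hG0 _) (hG1 _)
  filter_upwards [ae_all_iff.2 H] with ω hω using hω _ rfl

/-- If a family `G σ` of functions of the sample satisfies a bound `∫ w * G σ ≤ K * ∫ w` for all
weights `w` depending only on the first components, then `G π` has expectation at most `K`. -/
lemma IsUniformOrdering.integral_le (hπ : IsUniformOrdering P x y π)
    (hx : ∀ i, Measurable (x i)) (hy : ∀ i, Measurable (y i))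
    {G : Equiv.Perm (Fin n) → (Fin n → ℝ × ℝ) → ℝ} (hG : ∀ σ, Measurable (G σ)) {C : ℝ}
    (hC : ∀ σ z, |G σ z| ≤ C) {K : ℝ}
    (hK : ∀ σ, ∀ w : (Fin n → ℝ × ℝ) → ℝ, Measurable w → (∀ z, 0 ≤ w z) → (∀ z, w z ≤ 1) →
      (∀ z z', (∀ i, (z i).1 = (z' i).1) → w z = w z') →
      ∫ z, w z * G σ z ∂P.map (fun ω i => (x i ω, y i ω)) ≤
        K * ∫ z, w z ∂P.map (fun ω i => (x i ω, y i ω))) :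
    Integrable (fun ω => G (π ω) (fun i => (x i ω, y i ω))) P ∧
      ∫ ω, G (π ω) (fun i => (x i ω, y i ω)) ∂P ≤ K := by
  classical
  have hZ := measurable_sample hx hy
  have hfst : Measurable fun (z : Fin n → ℝ × ℝ) (i : Fin n) => (z i).1 := by fun_prop
  have hsplit : ∀ H : Equiv.Perm (Fin n) → (Fin n → ℝ × ℝ) → ℝ,
      (fun ω => H (π ω) (fun i => (x i ω, y i ω))) = fun ω => ∑ σ,
        {ω | π ω = σ}.indicator (fun _ => (1 : ℝ)) ω * H σ (fun i => (x i ω, y i ω)) := by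
    intro H
    ext ω
    simp [Set.indicator_apply]
  have hint : ∀ H : Equiv.Perm (Fin n) → (Fin n → ℝ × ℝ) → ℝ, (∀ σ, Measurable (H σ)) →
      ∀ C : ℝ, (∀ σ z, |H σ z| ≤ C) → ∀ σ, Integrable (fun ω =>
        {ω | π ω = σ}.indicator (fun _ => (1 : ℝ)) ω * H σ (fun i => (x i ω, y i ω))) P := by
    intro H hH C hC σ
    refine integrable_of_abs_le (C := 1 * C) ((measurable_const.indicator
      (hπ.measurableSet_eq σ)).mul ((hH σ).comp hZ)) fun ω => ?_
    rw [abs_mul]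
    refine mul_le_mul ?_ (hC _ _) (abs_nonneg _) zero_le_one
    rw [Set.indicator_apply]; split_ifs <;> simp
  constructor
  · rw [hsplit]
    exact integrable_finsetSum _ fun σ _ => hint G hG C hC σ
  · have hone : ∑ σ, ∫ ω, orderingWeight σ (fun i => x i ω) ∂P = 1 := by
      have h1 := hsplit fun _ _ => 1
      have h2 : ∫ _, (1 : ℝ) ∂P = 1 := by simp
      rw [h1, integral_finsetSum _ fun σ _ => hint (fun _ _ => 1) (fun _ => measurable_const) 1
        (by simp) σ] at h2
      rw [← h2]
      refine Finset.sum_congr rfl fun σ _ => ?_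
      rw [hπ.integral_indicator_mul hx hy σ (G := fun _ => 1) measurable_const (C := 1) (by simp)]
      simp
    have hmap : ∀ (σ : Equiv.Perm (Fin n)) (H : (Fin n → ℝ × ℝ) → ℝ), Measurable H →
        ∫ z, orderingWeight σ (fun i => (z i).1) * H z ∂P.map (fun ω i => (x i ω, y i ω)) =
          ∫ ω, orderingWeight σ (fun i => x i ω) * H (fun i => (x i ω, y i ω)) ∂P := by
      intro σ H hH
      exact integral_map hZ.aemeasurable
        ((((measurable_orderingWeight σ).comp hfst).mul hH).aestronglyMeasurable)
    rw [hsplit, integral_finsetSum _ fun σ _ => hint G hG C hC σ]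
    calc _ ≤ ∑ σ, K * ∫ ω, orderingWeight σ (fun i => x i ω) ∂P := by
          refine Finset.sum_le_sum fun σ _ => ?_
          rw [hπ.integral_indicator_mul hx hy σ (hG σ) (hC σ), ← hmap σ _ (hG σ)]
          refine (hK σ _ ((measurable_orderingWeight σ).comp hfst)
            (fun z => orderingWeight_nonneg _ _) (fun z => orderingWeight_le_one _ _)
            fun z z' h => ?_).trans (le_of_eq ?_)
          · simp only [Function.comp_apply, h]
          · have := hmap σ (fun _ => 1) measurable_const
            simp only [mul_one] at this
            simp only [Function.comp_apply, this]
      _ = K := by rw [← Finset.mul_sum, hone, mul_one]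

end UniformOrdering

/-! ### Almost sure convergence of centred sums along the ordering -/

section AlmostSure

variable {Ω : Type*} [MeasurableSpace Ω] {P : Measure Ω} [IsProbabilityMeasure P]

/-- Exponential tail bound for the sums of `integral_mul_exp_sum_le` along the random ordering. -/
lemma measureReal_le_abs_sum_le {m n : ℕ} {x y : Fin n → Ω → ℝ} {π : Ω → Equiv.Perm (Fin n)}
    (hπ : IsUniformOrdering P x y π) (hx : ∀ i, Measurable (x i)) (hy : ∀ i, Measurable (y i))
    {μ : Measure ℝ} [IsProbabilityMeasure μ] {κ : Kernel ℝ ℝ} [IsMarkovKernel κ]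
    (hlaw : P.map (fun ω i => (x i ω, y i ω)) = Measure.pi fun _ : Fin n => μ ⊗ₘ κ)
    {p : Equiv.Perm (Fin n) → Fin m → Fin n} (hp : ∀ σ, Function.Injective (p σ))
    {a : ℝ × ℝ → ℝ} (ha : Measurable a) {A : ℝ}
    (haA : ∀ q, |a q| ≤ A) (ha0 : ∀ x, ∫ y, a (x, y) ∂κ x = 0)
    {v : Equiv.Perm (Fin n) → Fin m → (Fin n → ℝ × ℝ) → ℝ} (hv : ∀ σ i, Measurable (v σ i))
    {B : ℝ} (hvB : ∀ σ i z, |v σ i z| ≤ B)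
    (hvp : ∀ σ i k, k ≤ i → ∀ z z', (∀ l, l ≠ p σ k → z l = z' l) →
      (z (p σ k)).1 = (z' (p σ k)).1 → v σ i z = v σ i z')
    {t : ℝ} (ht0 : 0 ≤ t) (ht : t * (A * B) ≤ 1) (r : ℝ) :
    P.real {ω | r ≤ |∑ i, a (x (p (π ω) i) ω, y (p (π ω) i) ω) *
        v (π ω) i (fun j => (x j ω, y j ω))|} ≤
      Real.exp (-(t * r)) * (2 * (1 + (t * (A * B)) ^ 2) ^ m) := by
  set T : Equiv.Perm (Fin n) → (Fin n → ℝ × ℝ) → ℝ := fun σ z => ∑ i, a (z (p σ i)) * v σ i z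
    with hT
  have hTm : ∀ σ, Measurable (T σ) := fun σ => Finset.measurable_sum _ fun i _ =>
    (ha.comp (measurable_pi_apply _)).mul (hv σ i)
  have hTb : ∀ σ z, |T σ z| ≤ m * (A * B) := fun σ z => by
    refine (Finset.abs_sum_le_sum_abs _ _).trans ?_
    have := Finset.sum_le_card_nsmul Finset.univ (fun i => |a (z (p σ i)) * v σ i z|) (A * B)
      fun i _ => by
        rw [abs_mul]
        exact mul_le_mul (haA _) (hvB _ _ _) (abs_nonneg _) ((abs_nonneg _).trans (haA (z (p σ i))))
    simpa using this
  have hexp : ∀ s : ℝ, |s| = t → ∀ σ z, Real.exp (s * T σ z) ≤ Real.exp (t * (m * (A * B))) := by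
    intro s hs σ z
    refine Real.exp_le_exp.2 ((le_abs_self _).trans ?_)
    rw [abs_mul, hs]
    exact mul_le_mul_of_nonneg_left (hTb σ z) ht0
  have habs : |-t| = t := by rw [abs_neg, abs_of_nonneg ht0]
  have hexpm : ∀ s : ℝ, ∀ σ, Measurable fun z => Real.exp (s * T σ z) := fun s σ =>
    Real.measurable_exp.comp ((hTm σ).const_mul s)
  obtain ⟨hint, hle⟩ := hπ.integral_le hx hy
    (G := fun σ z => Real.exp (t * T σ z) + Real.exp (-t * T σ z))
    (fun σ => (hexpm t σ).add (hexpm (-t) σ))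
    (C := Real.exp (t * (m * (A * B))) + Real.exp (t * (m * (A * B))))
    (fun σ z => by
      rw [abs_of_nonneg (by positivity)]
      exact add_le_add (hexp t (abs_of_nonneg ht0) σ z) (hexp (-t) habs σ z))
    (K := 2 * (1 + (t * (A * B)) ^ 2) ^ m)
    (fun σ w hw hw0 hw1 hwx => by
      rw [hlaw]
      have hI : ∀ s : ℝ, |s| = t → Integrable (fun z => w z * Real.exp (s * T σ z))
          (Measure.pi fun _ : Fin n => μ ⊗ₘ κ) := fun s hs => by
        refine integrable_of_abs_le (C := 1 * Real.exp (t * (m * (A * B)))) (hw.mul (hexpm s σ))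
          fun z => ?_
        rw [abs_of_nonneg (mul_nonneg (hw0 z) (Real.exp_pos _).le)]
        exact mul_le_mul (hw1 z) (hexp s hs σ z) (Real.exp_pos _).le zero_le_one
      simp only [mul_add]
      rw [integral_add (hI t (abs_of_nonneg ht0)) (hI (-t) habs)]
      have h1 := integral_mul_exp_sum_le μ κ (hp σ) ha haA ha0 hw hw0 hw1 hwx (hv σ) (hvB σ)
        (hvp σ) (t := t) (by rwa [abs_of_nonneg ht0])
      have h2 := integral_mul_exp_sum_le μ κ (hp σ) ha haA ha0 hw hw0 hw1 hwx (hv σ) (hvB σ)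
        (hvp σ) (t := -t) (by rwa [habs])
      rw [neg_mul (t) (A * B), neg_sq] at h2
      linarith)
  have hmarkov := mul_meas_ge_le_integral_of_nonneg (ae_of_all _ fun ω => by positivity) hint
    (Real.exp (t * r))
  have hsub : P.real {ω | r ≤ |T (π ω) (fun j => (x j ω, y j ω))|} ≤
      P.real {ω | Real.exp (t * r) ≤ Real.exp (t * T (π ω) (fun j => (x j ω, y j ω))) +
        Real.exp (-t * T (π ω) (fun j => (x j ω, y j ω)))} := by
    refine measureReal_mono fun ω hω => ?_
    simp only [Set.mem_ofPred_eq] at hω ⊢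
    rcases le_abs.1 hω with h | h
    · have := Real.exp_le_exp.2 (mul_le_mul_of_nonneg_left h ht0)
      linarith [Real.exp_pos (-t * T (π ω) (fun j => (x j ω, y j ω)))]
    · have := Real.exp_le_exp.2 (mul_le_mul_of_nonneg_left h ht0)
      rw [mul_neg, ← neg_mul] at this
      linarith [Real.exp_pos (t * T (π ω) (fun j => (x j ω, y j ω)))]
  have hfin := (mul_le_mul_of_nonneg_left hsub (Real.exp_pos (t * r)).le).trans (hmarkov.trans hle)
  rw [Real.exp_neg, ← div_eq_inv_mul, le_div_iff₀ (Real.exp_pos _), mul_comm]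
  exact hfin

/-- The sums of `integral_mul_exp_sum_le` along the random orderings are `o(n)` almost surely. -/
lemma ae_tendsto_centred_sum_div {Xs Ys : ℕ → Ω → ℝ} (hXs : ∀ i, Measurable (Xs i))
    (hYs : ∀ i, Measurable (Ys i)) {π : (n : ℕ) → Ω → Equiv.Perm (Fin n)}
    (hπ : ∀ n, IsUniformOrdering P (fun i : Fin n => Xs i) (fun i : Fin n => Ys i) (π n))
    {μ : Measure ℝ} [IsProbabilityMeasure μ] {κ : Kernel ℝ ℝ} [IsMarkovKernel κ]
    (hlaw : ∀ n, P.map (fun ω (i : Fin n) => (Xs i ω, Ys i ω)) =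
      Measure.pi fun _ : Fin n => μ ⊗ₘ κ)
    {p : ∀ m, Equiv.Perm (Fin (m + 1)) → Fin m → Fin (m + 1)}
    (hp : ∀ m σ, Function.Injective (p m σ))
    {a : ℝ × ℝ → ℝ} (ha : Measurable a) {A : ℝ} (hA : 1 ≤ A)
    (haA : ∀ q, |a q| ≤ A) (ha0 : ∀ x, ∫ y, a (x, y) ∂κ x = 0)
    {v : ∀ m, Equiv.Perm (Fin (m + 1)) → Fin m → (Fin (m + 1) → ℝ × ℝ) → ℝ}
    (hv : ∀ m σ i, Measurable (v m σ i))
    {B : ℝ} (hB : 1 ≤ B) (hvB : ∀ m σ i z, |v m σ i z| ≤ B)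
    (hvp : ∀ m σ i k, k ≤ i → ∀ z z', (∀ l, l ≠ p m σ k → z l = z' l) →
      (z (p m σ k)).1 = (z' (p m σ k)).1 → v m σ i z = v m σ i z') :
    ∀ᵐ ω ∂P, Tendsto (fun m : ℕ =>
      (∑ i, a (Xs (p m (π (m + 1) ω) i) ω, Ys (p m (π (m + 1) ω) i) ω) *
        v m (π (m + 1) ω) i (fun j => (Xs j ω, Ys j ω))) / ((m : ℝ) + 1)) atTop (𝓝 0) := by
  set T : ℕ → Ω → ℝ := fun m ω => ∑ i, a (Xs (p m (π (m + 1) ω) i) ω, Ys (p m (π (m + 1) ω) i) ω) *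
        v m (π (m + 1) ω) i (fun j => (Xs j ω, Ys j ω)) with hT
  have hC : 1 ≤ A * B := one_le_mul_of_one_le_of_one_le hA hB
  have H : ∀ k : ℕ, ∀ᵐ ω ∂P, ∀ᶠ m : ℕ in atTop,
      ω ∉ {ω | 1 / ((k : ℝ) + 1) * ((m : ℝ) + 1) ≤ |T m ω|} := by
    intro k
    set ε : ℝ := 1 / ((k : ℝ) + 1) with hε
    have hε0 : 0 < ε := by positivity
    have hε1 : ε ≤ 1 := by
      rw [hε, div_le_one (by positivity)]
      linarith [(Nat.cast_nonneg k : (0 : ℝ) ≤ k)]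
    -- The choice of `t` minimises `(t * (A * B)) ^ 2 - t * ε`.
    set t := ε / (2 * (A * B) ^ 2) with ht
    set q := (t * (A * B)) ^ 2 with hq
    have ht0 : 0 ≤ t := by positivity
    have htC : t * (A * B) = ε / (2 * (A * B)) := by rw [ht]; field_simp
    have htle : t * (A * B) ≤ 1 := by
      rw [htC, div_le_one (by positivity)]; linarith
    have hq0 : 0 < q := by rw [hq, htC]; positivity
    have htε : t * ε = 2 * q := by rw [hq, htC, ht]; field_simp
    refine ae_eventually_notMem (ne_top_of_le_ne_top (b := ∑' m : ℕ,
      ENNReal.ofReal (2 * Real.exp (-q) ^ m)) ?_ (ENNReal.tsum_le_tsum fun m => ?_))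
    · refine Summable.tsum_ofReal_ne_top (Summable.mul_left _ (summable_geometric_of_lt_one
        (Real.exp_pos _).le ?_))
      rw [Real.exp_lt_one_iff]; linarith
    · have h := measureReal_le_abs_sum_le (hπ (m + 1)) (fun i => hXs i) (fun i => hYs i)
        (hlaw (m + 1)) (hp m) ha haA ha0 (hv m) (hvB m) (hvp m) ht0 htle (ε * ((m : ℝ) + 1))
      rw [← ofReal_measureReal]
      refine ENNReal.ofReal_le_ofReal (h.trans ?_)
      have h1 : (1 + q) ^ m ≤ Real.exp (q * m) := by
        rw [mul_comm q, Real.exp_nat_mul]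
        exact pow_le_pow_left₀ (by positivity) (by linarith [Real.add_one_le_exp q]) m
      calc Real.exp (-(t * (ε * ((m : ℝ) + 1)))) * (2 * (1 + q) ^ m)
          ≤ Real.exp (-(2 * q * m)) * (2 * Real.exp (q * m)) := by
            refine mul_le_mul (Real.exp_le_exp.2 ?_) (by linarith) (by positivity)
              (Real.exp_pos _).le
            rw [← mul_assoc, htε]; linarith
        _ = 2 * Real.exp (-q) ^ m := by
            rw [← Real.exp_nat_mul, mul_left_comm, ← Real.exp_add]; congr 2; ring
  filter_upwards [ae_all_iff.2 H] with ω hω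
  rw [Metric.tendsto_atTop]
  intro ε hε
  obtain ⟨k, hk⟩ := exists_nat_one_div_lt hε
  obtain ⟨N, hN⟩ := eventually_atTop.1 (hω k)
  refine ⟨N, fun m hm => ?_⟩
  have h1 := hN m hm
  simp only [not_le] at h1
  rw [dist_zero_right, Real.norm_eq_abs, abs_div, abs_of_pos (by positivity : (0 : ℝ) < m + 1),
    div_lt_iff₀ (by positivity)]
  exact h1.trans (mul_lt_mul_of_pos_right hk (by positivity))

end AlmostSure

/-! ### Approximation by functions of bounded variation -/

section Variation

lemma sum_succ_sub_castSucc {m : ℕ} (u : Fin (m + 1) → ℝ) :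
    ∑ i : Fin m, (u i.succ - u i.castSucc) = u (Fin.last m) - u 0 := by
  have h1 := Fin.sum_univ_succ u
  have h2 := Fin.sum_univ_castSucc u
  rw [Finset.sum_sub_distrib]
  linarith

/-- Functions of bounded variation are dense in `L¹`. -/
lemma exists_boundedVariation_integral_sub_le {μ : Measure ℝ} [IsFiniteMeasure μ] {g : ℝ → ℝ}
    (hg : Integrable g μ) {ε : ℝ} (hε : 0 < ε) :
    ∃ (ψ : ℝ → ℝ) (V : ℝ), Measurable ψ ∧ Integrable ψ μ ∧ ∫ x, |g x - ψ x| ∂μ ≤ ε ∧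
      ∀ (m : ℕ) (x : Fin (m + 1) → ℝ), Monotone x →
        ∑ i : Fin m, |ψ (x i.succ) - ψ (x i.castSucc)| ≤ V := by
  obtain ⟨ψ, hψc, hψs, hψ⟩ := (memLp_one_iff_integrable.2 hg).exist_eLpNorm_sub_le (by simp)
    le_rfl hε
  obtain ⟨K, hK⟩ := hψs.lipschitzWith_of_hasCompactSupport hψc (by simp)
  obtain ⟨R, hR⟩ := hψc.isCompact.isBounded.subset_closedBall 0
  have hψ0 : ∀ x, R < |x| → ψ x = 0 := fun x hx => by
    by_contra h
    have := hR (subset_tsupport ψ h)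
    rw [mem_closedBall_zero_iff, Real.norm_eq_abs] at this
    linarith
  set M := max R 0 + 1
  have hM : R < M := lt_of_le_of_lt (le_max_left _ _) (lt_add_one _)
  have hM0 : 0 < M := by positivity
  -- `ψ` is a Lipschitz function of the bounded monotone function `c`.
  set c : ℝ → ℝ := fun x => max (-M) (min M x) with hc
  have hcmono : Monotone c := fun x y h => max_le_max le_rfl (min_le_min le_rfl h)
  have hcle : ∀ x, c x ≤ M := fun x => max_le (by linarith) (min_le_left _ _)
  have hlec : ∀ x, -M ≤ c x := fun x => le_max_left _ _
  have hψc' : ∀ x, ψ x = ψ (c x) := by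
    intro x
    rcases lt_or_ge M x with h | h
    · rw [hψ0 x (hM.trans (h.trans_le (le_abs_self x)))]
      simp only [hc]
      rw [min_eq_left h.le, max_eq_right (by linarith), hψ0 M (hM.trans_le (le_abs_self M))]
    rcases lt_or_ge x (-M) with h' | h'
    · rw [hψ0 x (hM.trans_le (by rw [le_abs]; right; linarith))]
      simp only [hc]
      rw [min_eq_right h, max_eq_left h'.le, hψ0 (-M) (by rw [abs_neg, abs_of_pos hM0]; exact hM)]
    · simp only [hc]
      rw [min_eq_right h, max_eq_right h']
  have hψi : Integrable ψ μ := hψs.continuous.integrable_of_hasCompactSupport hψc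
  refine ⟨ψ, K * (2 * M), hψs.continuous.measurable, hψi, ?_, fun m x hx => ?_⟩
  · have h1 : ∫ x, ‖(g - ψ) x‖ ∂μ = (eLpNorm (g - ψ) 1 μ).toReal := by
      rw [eLpNorm_one_eq_lintegral_enorm,
        integral_norm_eq_lintegral_enorm (hg.sub hψi).aestronglyMeasurable]
    have h2 := ENNReal.toReal_mono ENNReal.ofReal_ne_top hψ
    rw [← h1, ENNReal.toReal_ofReal hε.le] at h2
    exact h2
  · calc ∑ i : Fin m, |ψ (x i.succ) - ψ (x i.castSucc)|
        ≤ ∑ i : Fin m, K * (c (x i.succ) - c (x i.castSucc)) := by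
          refine Finset.sum_le_sum fun i _ => ?_
          have h := hK.dist_le_mul (c (x i.succ)) (c (x i.castSucc))
          rw [Real.dist_eq, Real.dist_eq, ← hψc', ← hψc', abs_of_nonneg (a := c _ - c _)
            (sub_nonneg.2 (hcmono (hx (Fin.castSucc_le_succ i))))] at h
          exact h
      _ = K * (c (x (Fin.last m)) - c (x 0)) := by
          rw [← Finset.mul_sum, sum_succ_sub_castSucc fun i => c (x i)]
      _ ≤ K * (2 * M) := by
          refine mul_le_mul_of_nonneg_left ?_ K.2
          linarith [hcle (x (Fin.last m)), hlec (x 0)]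

end Variation

/-! ### I.i.d. samples and product kernels -/

section Sample

variable {Ω : Type*} [MeasurableSpace Ω] {P : Measure Ω}

/-- The pairs `(Xs i, Ys i)` are independent with common law `ρ`. -/
structure IsIIDSample (P : Measure Ω) (Xs Ys : ℕ → Ω → ℝ) (ρ : Measure (ℝ × ℝ)) : Prop where
  measurable_left : ∀ i, Measurable (Xs i)
  measurable_right : ∀ i, Measurable (Ys i)
  indep : iIndepFun (fun i ω => (Xs i ω, Ys i ω)) P
  map_eq : ∀ i, P.map (fun ω => (Xs i ω, Ys i ω)) = ρ

variable {Xs Ys : ℕ → Ω → ℝ} {ρ : Measure (ℝ × ℝ)}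

lemma IsIIDSample.measurable (hS : IsIIDSample P Xs Ys ρ) (i : ℕ) :
    Measurable fun ω => (Xs i ω, Ys i ω) :=
  (hS.measurable_left i).prodMk (hS.measurable_right i)

lemma IsIIDSample.ae_tendsto_mean (hS : IsIIDSample P Xs Ys ρ) {φ : ℝ × ℝ → ℝ}
    (hφ : Measurable φ) (hφi : Integrable φ ρ) :
    ∀ᵐ ω ∂P, Tendsto (fun n : ℕ => (∑ i : Fin n, φ (Xs i ω, Ys i ω)) / (n : ℝ)) atTop
      (𝓝 (∫ z, φ z ∂ρ)) := by
  have hmap := integral_map (μ := P) (hS.measurable 0).aemeasurable (f := φ) hφ.aestronglyMeasurable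
  rw [hS.map_eq 0] at hmap
  have hint : Integrable (fun ω => φ (Xs 0 ω, Ys 0 ω)) P := by
    rw [← hS.map_eq 0] at hφi
    exact hφi.comp_measurable (hS.measurable 0)
  have h := strong_law_ae_real (fun i ω => φ (Xs i ω, Ys i ω)) hint
    (fun i j hij => (hS.indep.indepFun hij).comp hφ hφ)
    fun i => (IdentDistrib.mk (hS.measurable i).aemeasurable (hS.measurable 0).aemeasurable
      (by rw [hS.map_eq, hS.map_eq])).comp hφ
  rw [← hmap] at h
  filter_upwards [h] with ω hω
  simpa only [Finset.sum_range] using hω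

lemma IsIIDSample.ae_tendsto_mean_succ (hS : IsIIDSample P Xs Ys ρ) {φ : ℝ × ℝ → ℝ}
    (hφ : Measurable φ) (hφi : Integrable φ ρ) :
    ∀ᵐ ω ∂P, Tendsto (fun m : ℕ => (∑ i : Fin (m + 1), φ (Xs i ω, Ys i ω)) / ((m : ℝ) + 1)) atTop
      (𝓝 (∫ z, φ z ∂ρ)) := by
  filter_upwards [hS.ae_tendsto_mean hφ hφi] with ω hω
  simpa using (tendsto_add_atTop_iff_nat 1).2 hω

variable [IsProbabilityMeasure P]

lemma IsIIDSample.map_pi_eq (hS : IsIIDSample P Xs Ys ρ) (n : ℕ) :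
    P.map (fun ω (i : Fin n) => (Xs i ω, Ys i ω)) = Measure.pi fun _ : Fin n => ρ := by
  have h := (hS.indep.precomp (g := fun i : Fin n => (i : ℕ)) Fin.val_injective)
  have h' := (iIndepFun_iff_map_fun_eq_pi_map fun i : Fin n => (hS.measurable i).aemeasurable).1 h
  simpa only [hS.map_eq] using h'

variable {μ : Measure ℝ} [IsProbabilityMeasure μ] {κ : Kernel ℝ ℝ} [IsMarkovKernel κ]
  {π : (n : ℕ) → Ω → Equiv.Perm (Fin n)}

/-- Consecutive values of an integrable function along the sorted sample are close on average. -/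
lemma IsIIDSample.ae_tendsto_sum_abs_sub (hS : IsIIDSample P Xs Ys (μ ⊗ₘ κ))
    (hπ : ∀ n, IsUniformOrdering P (fun i : Fin n => Xs i) (fun i : Fin n => Ys i) (π n))
    {g : ℝ → ℝ} (hgm : Measurable g) (hg : Integrable g μ) :
    ∀ᵐ ω ∂P, Tendsto (fun m : ℕ => (∑ i : Fin m, |g (Xs (π (m + 1) ω i.succ) ω) -
      g (Xs (π (m + 1) ω i.castSucc) ω)|) / ((m : ℝ) + 1)) atTop (𝓝 0) := by
  choose ψ V hψm hψi hψ hV using fun k : ℕ =>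
    exists_boundedVariation_integral_sub_le hg (ε := 1 / ((k : ℝ) + 1)) (by positivity)
  have hsort : ∀ᵐ ω ∂P, ∀ n : ℕ, π n ω ∈ sortingPerms (fun i : Fin n => Xs i ω) :=
    ae_all_iff.2 fun n => (hπ n).ae_mem_sortingPerms (fun i => hS.measurable_left i)
      fun i => hS.measurable_right i
  have hmean : ∀ᵐ ω ∂P, ∀ k, Tendsto (fun m : ℕ =>
      (∑ i : Fin (m + 1), |g (Xs i ω) - ψ k (Xs i ω)|) / ((m : ℝ) + 1)) atTop
      (𝓝 (∫ x, |g x - ψ k x| ∂μ)) := by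
    refine ae_all_iff.2 fun k => ?_
    have hm : Measurable fun x => |g x - ψ k x| := (hgm.sub (hψm k)).abs
    have hi : Integrable (fun z : ℝ × ℝ => |g z.1 - ψ k z.1|) (μ ⊗ₘ κ) := by
      have := (hg.sub (hψi k)).abs
      rw [← Measure.fst_compProd μ κ] at this
      exact this.comp_measurable measurable_fst
    have := hS.ae_tendsto_mean_succ (φ := fun z => |g z.1 - ψ k z.1|) (hm.comp measurable_fst) hi
    rw [Measure.integral_compProd hi] at this
    simpa using this
  filter_upwards [hsort, hmean] with ω hω1 hω2
  rw [Metric.tendsto_atTop]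
  intro ε hε
  obtain ⟨k, hk⟩ := exists_nat_one_div_lt (show 0 < ε / 3 by positivity)
  have h1 : ∀ᶠ m : ℕ in atTop,
      (∑ i : Fin (m + 1), |g (Xs i ω) - ψ k (Xs i ω)|) / ((m : ℝ) + 1) < ε / 3 :=
    (hω2 k).eventually_lt_const ((hψ k).trans_lt hk)
  have h2 : ∀ᶠ m : ℕ in atTop, V k / ((m : ℝ) + 1) < ε / 3 := by
    have : Tendsto (fun m : ℕ => V k / ((m : ℝ) + 1)) atTop (𝓝 0) :=
      tendsto_const_nhds.div_atTop (tendsto_atTop_add_const_right _ _ tendsto_natCast_atTop_atTop)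
    exact this.eventually_lt_const (by positivity)
  obtain ⟨N, hN⟩ := eventually_atTop.1 (h1.and h2)
  refine ⟨N, fun m hm => ?_⟩
  obtain ⟨hm1, hm2⟩ := hN m hm
  rw [dist_zero_right, Real.norm_eq_abs, abs_of_nonneg (by positivity)]
  set σ := π (m + 1) ω with hσ
  set D : Fin (m + 1) → ℝ := fun j => |g (Xs j ω) - ψ k (Xs j ω)| with hD
  have hDsum : ∑ i, D (σ i) = ∑ j, D j := Equiv.sum_comp σ D
  have hs : ∑ i : Fin m, D (σ i.succ) ≤ ∑ j, D j := by
    rw [← hDsum, Fin.sum_univ_succ]; linarith [abs_nonneg (g (Xs (σ 0) ω) - ψ k (Xs (σ 0) ω))]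
  have hcs : ∑ i : Fin m, D (σ i.castSucc) ≤ ∑ j, D j := by
    rw [← hDsum, Fin.sum_univ_castSucc]
    linarith [abs_nonneg (g (Xs (σ (Fin.last m)) ω) - ψ k (Xs (σ (Fin.last m)) ω))]
  have hv := hV k m _ (mem_sortingPerms.1 (hω1 (m + 1)))
  have hle : ∑ i : Fin m, |g (Xs (σ i.succ) ω) - g (Xs (σ i.castSucc) ω)| ≤
      2 * ∑ j, D j + V k := by
    calc _ ≤ ∑ i : Fin m, (D (σ i.succ) + |ψ k (Xs (σ i.succ) ω) - ψ k (Xs (σ i.castSucc) ω)| +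
          D (σ i.castSucc)) := by
          refine Finset.sum_le_sum fun i _ => ?_
          have e1 := abs_sub_le (g (Xs (σ i.succ) ω)) (ψ k (Xs (σ i.succ) ω))
            (g (Xs (σ i.castSucc) ω))
          have e2 := abs_sub_le (ψ k (Xs (σ i.succ) ω)) (ψ k (Xs (σ i.castSucc) ω))
            (g (Xs (σ i.castSucc) ω))
          rw [abs_sub_comm (ψ k (Xs (σ i.castSucc) ω)) (g _)] at e2
          simp only [hD]
          linarith
      _ ≤ _ := by
          rw [Finset.sum_add_distrib, Finset.sum_add_distrib]
          linarith
  calc _ ≤ (2 * ∑ j, D j + V k) / ((m : ℝ) + 1) := by gcongr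
    _ = 2 * ((∑ j, D j) / ((m : ℝ) + 1)) + V k / ((m : ℝ) + 1) := by ring
    _ < ε := by linarith

lemma integral_kernel_abs_le (κ : Kernel ℝ ℝ) [IsMarkovKernel κ] {f : ℝ → ℝ} {C : ℝ}
    (hC : ∀ y, |f y| ≤ C) (x : ℝ) : |∫ y, f y ∂κ x| ≤ C := by
  simpa using norm_integral_le_of_norm_le_const (μ := κ x) (f := f) (ae_of_all _ hC)

lemma measurable_integral_kernel (κ : Kernel ℝ ℝ) [IsMarkovKernel κ] {f : ℝ → ℝ}
    (hf : Measurable f) : Measurable fun x => ∫ y, f y ∂κ x :=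
  (hf.stronglyMeasurable.integral_kernel (κ := κ)).measurable

/-- The variation statistic of a product kernel `f(y) g(z)` converges to
`∫ E[f(Y) | X = x] E[g(Y) | X = x] dμ(x)`. -/
lemma IsIIDSample.ae_tendsto_variation_mul (hS : IsIIDSample P Xs Ys (μ ⊗ₘ κ))
    (hπ : ∀ n, IsUniformOrdering P (fun i : Fin n => Xs i) (fun i : Fin n => Ys i) (π n))
    {f g : ℝ → ℝ} (hf : Measurable f) (hg : Measurable g) {C : ℝ}
    (hfC : ∀ y, |f y| ≤ C) (hgC : ∀ y, |g y| ≤ C) :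
    ∀ᵐ ω ∂P, Tendsto (fun m : ℕ => (∑ i : Fin m, f (Ys (π (m + 1) ω i.castSucc) ω) *
      g (Ys (π (m + 1) ω i.succ) ω)) / ((m : ℝ) + 1)) atTop
      (𝓝 (∫ x, (∫ y, f y ∂κ x) * (∫ y, g y ∂κ x) ∂μ)) := by
  wlog hC1 : 1 ≤ C generalizing C
  · exact this (C := max C 1) (fun y => (hfC y).trans (le_max_left _ _))
      (fun y => (hgC y).trans (le_max_left _ _)) (le_max_right _ _)
  set f' : ℝ → ℝ := fun x => ∫ y, f y ∂κ x with hf'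
  set g' : ℝ → ℝ := fun x => ∫ y, g y ∂κ x with hg'
  have hf'm : Measurable f' := measurable_integral_kernel κ hf
  have hg'm : Measurable g' := measurable_integral_kernel κ hg
  have hf'C : ∀ x, |f' x| ≤ C := integral_kernel_abs_le κ hfC
  have hg'C : ∀ x, |g' x| ≤ C := integral_kernel_abs_le κ hgC
  have hcm : ∀ u : ℝ → ℝ, Measurable u → Measurable fun q : ℝ × ℝ => u q.2 - ∫ y, u y ∂κ q.1 :=
    fun u hu => (hu.comp measurable_snd).sub ((measurable_integral_kernel κ hu).comp measurable_fst)
  have hcb : ∀ u : ℝ → ℝ, (∀ y, |u y| ≤ C) → ∀ q : ℝ × ℝ, |u q.2 - ∫ y, u y ∂κ q.1| ≤ 2 * C :=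
    fun u hu q => (abs_sub _ _).trans (by linarith [hu q.2, integral_kernel_abs_le κ hu q.1])
  have hc0 : ∀ u : ℝ → ℝ, Measurable u → (∀ y, |u y| ≤ C) → ∀ x : ℝ,
      ∫ y, (u (x, y).2 - ∫ y, u y ∂κ (x, y).1) ∂κ x = 0 := fun u hum hu x => by
    simp only
    rw [integral_sub (integrable_of_abs_le hum hu) (integrable_const _)]
    simp
  -- In the first sum the centred factor sits at position `i` and the other factor at position
  -- `i + 1`; in the second one it is the other way round, with a factor that only sees `x`.
  have h1 := ae_tendsto_centred_sum_div hS.measurable_left hS.measurable_right hπ hS.map_pi_eq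
    (p := fun m σ i => σ i.castSucc)
    (fun m σ => σ.injective.comp (Fin.castSucc_injective m)) (hcm f hf) (by linarith) (hcb f hfC)
    (hc0 f hf hfC) (v := fun m σ i z => g (z (σ i.succ)).2)
    (fun m σ i => hg.comp (measurable_snd.comp (measurable_pi_apply _))) hC1
    (fun m σ i z => hgC _) fun m σ i k hki z z' h _ => by
      have : σ i.succ ≠ σ k.castSucc := fun h => by
        have h2 := σ.injective h
        have := congrArg Fin.val h2
        simp only [Fin.val_succ, Fin.val_castSucc] at this
        have := Fin.le_def.1 hki
        omega
      rw [h _ this]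
  have h2 := ae_tendsto_centred_sum_div hS.measurable_left hS.measurable_right hπ hS.map_pi_eq
    (p := fun m σ i => σ i.succ)
    (fun m σ => σ.injective.comp (Fin.succ_injective m)) (hcm g hg) (by linarith) (hcb g hgC)
    (hc0 g hg hgC) (v := fun m σ i z => f' (z (σ i.castSucc)).1)
    (fun m σ i => hf'm.comp (measurable_fst.comp (measurable_pi_apply _))) hC1
    (fun m σ i z => hf'C _) fun m σ i k hki z z' h h' => by
      by_cases hik : σ i.castSucc = σ k.succ
      · rw [hik, h']
      · rw [h _ hik]
  have h3 := hS.ae_tendsto_sum_abs_sub hπ hg'm (integrable_of_abs_le hg'm hg'C)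
  have hfg : Measurable fun z : ℝ × ℝ => f' z.1 * g' z.1 :=
    (hf'm.comp measurable_fst).mul (hg'm.comp measurable_fst)
  have hfgC : ∀ x, |f' x * g' x| ≤ C * C := fun x => by
    rw [abs_mul]
    exact mul_le_mul (hf'C x) (hg'C x) (abs_nonneg _) (by linarith)
  have hfgi : Integrable (fun z : ℝ × ℝ => f' z.1 * g' z.1) (μ ⊗ₘ κ) :=
    integrable_of_abs_le hfg fun z => hfgC _
  have h4 := hS.ae_tendsto_mean_succ hfg hfgi
  rw [Measure.integral_compProd hfgi] at h4
  simp only [integral_const, probReal_univ, one_smul] at h4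
  filter_upwards [h1, h2, h3, h4] with ω hω1 hω2 hω3 hω4
  have hinv : ∀ K : ℝ, Tendsto (fun m : ℕ => K / ((m : ℝ) + 1)) atTop (𝓝 0) := fun K =>
    tendsto_const_nhds.div_atTop (tendsto_atTop_add_const_right _ _ tendsto_natCast_atTop_atTop)
  have hω5 : Tendsto (fun m : ℕ => (∑ i : Fin m, f' (Xs (π (m + 1) ω i.castSucc) ω) *
      (g' (Xs (π (m + 1) ω i.succ) ω) - g' (Xs (π (m + 1) ω i.castSucc) ω))) / ((m : ℝ) + 1))
      atTop (𝓝 0) := by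
    refine squeeze_zero_norm (fun m => ?_) (by simpa using hω3.const_mul C)
    rw [Real.norm_eq_abs, abs_div, abs_of_pos (by positivity : (0 : ℝ) < m + 1), ← mul_div_assoc]
    refine div_le_div_of_nonneg_right ((Finset.abs_sum_le_sum_abs _ _).trans ?_) (by positivity)
    rw [Finset.mul_sum]
    refine Finset.sum_le_sum fun i _ => ?_
    rw [abs_mul]
    exact mul_le_mul_of_nonneg_right (hf'C _) (abs_nonneg _)
  have hω6 : Tendsto (fun m : ℕ => f' (Xs (π (m + 1) ω (Fin.last m)) ω) *
      g' (Xs (π (m + 1) ω (Fin.last m)) ω) / ((m : ℝ) + 1)) atTop (𝓝 0) := by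
    refine squeeze_zero_norm (fun m => ?_) (hinv (C * C))
    rw [Real.norm_eq_abs, abs_div, abs_of_pos (by positivity : (0 : ℝ) < m + 1)]
    exact div_le_div_of_nonneg_right (hfgC _) (by positivity)
  have hsum := (((hω1.add hω2).add hω5).add hω4).sub hω6
  simp only [zero_add, sub_zero] at hsum
  refine hsum.congr fun m => ?_
  rw [← add_div, ← add_div, ← add_div, ← sub_div]
  congr 1
  have e : ∑ j : Fin (m + 1), f' (Xs j ω) * g' (Xs j ω) =
      ∑ i : Fin m, f' (Xs (π (m + 1) ω i.castSucc) ω) * g' (Xs (π (m + 1) ω i.castSucc) ω) +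
        f' (Xs (π (m + 1) ω (Fin.last m)) ω) * g' (Xs (π (m + 1) ω (Fin.last m)) ω) := by
    rw [← Equiv.sum_comp (π (m + 1) ω), Fin.sum_univ_castSucc]
  rw [e, ← add_assoc, add_sub_cancel_right, ← Finset.sum_add_distrib, ← Finset.sum_add_distrib,
    ← Finset.sum_add_distrib]
  refine Finset.sum_congr rfl fun i _ => ?_
  simp only [hf', hg']
  ring

end Sample

/-! ### From product kernels to continuous kernels -/

section Approximation

lemma IsCDF.measurable {F : ℝ → unitInterval} (hF : IsCDF F) : Measurable F := by
  obtain ⟨ν, _, hν⟩ := hF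
  refine Monotone.measurable fun s t hst => ?_
  rw [← Subtype.coe_le_coe, hν, hν]
  exact monotone_cdf ν hst

lemma exists_abs_le_of_continuous {h : unitInterval → unitInterval → ℝ}
    (h_cont : Continuous fun p : unitInterval × unitInterval => h p.1 p.2) :
    ∃ C, ∀ u v, |h u v| ≤ C := by
  obtain ⟨C, hC⟩ := isCompact_univ.exists_bound_of_continuousOn h_cont.continuousOn
  exact ⟨C, fun u v => hC (u, v) (Set.mem_univ _)⟩

/-- A continuous function on the square is uniformly approximated by finite sums of products of
bounded measurable functions: discretise the first variable. -/
lemma exists_sum_mul_approx {h : unitInterval → unitInterval → ℝ}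
    (h_cont : Continuous fun p : unitInterval × unitInterval => h p.1 p.2) {ε : ℝ} (hε : 0 < ε) :
    ∃ (N : ℕ) (f g : ℕ → unitInterval → ℝ) (C : ℝ), (∀ k, Measurable (f k)) ∧
      (∀ k, Measurable (g k)) ∧ (∀ k u, |f k u| ≤ C) ∧ (∀ k u, |g k u| ≤ C) ∧
      ∀ u v, |h u v - ∑ k ∈ Finset.range N, f k u * g k v| ≤ ε := by
  obtain ⟨C, hC⟩ := exists_abs_le_of_continuous h_cont
  obtain ⟨δ, hδ, hδh⟩ := Metric.uniformContinuous_iff.1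
    (CompactSpace.uniformContinuous_of_continuous h_cont) ε hε
  obtain ⟨n, hn⟩ := exists_nat_one_div_lt hδ
  set c : ℕ → unitInterval := fun k => Set.projIcc 0 1 zero_le_one ((k : ℝ) / ((n : ℝ) + 1)) with hc
  have hidx : Measurable fun u : unitInterval => ⌊((n : ℝ) + 1) * (u : ℝ)⌋₊ :=
    Nat.measurable_floor.comp (measurable_subtype_coe.const_mul _)
  refine ⟨n + 2, fun k u => if ⌊((n : ℝ) + 1) * (u : ℝ)⌋₊ = k then 1 else 0, fun k v => h (c k) v,
    max C 1, fun k => ?_, fun k => ?_, fun k u => ?_, fun k u => (hC _ _).trans (le_max_left _ _),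
    fun u v => ?_⟩
  · exact Measurable.ite (hidx (measurableSet_singleton k)) measurable_const measurable_const
  · exact (h_cont.comp (Continuous.prodMk continuous_const continuous_id)).measurable
  · simp only
    split_ifs <;> simp
  · set k := ⌊((n : ℝ) + 1) * (u : ℝ)⌋₊ with hk
    have hn0 : (0 : ℝ) < (n : ℝ) + 1 := by positivity
    have hle : (k : ℝ) ≤ ((n : ℝ) + 1) * u := Nat.floor_le (mul_nonneg hn0.le u.2.1)
    have hlt : ((n : ℝ) + 1) * u < k + 1 := Nat.lt_floor_add_one _
    have hkn : k < n + 2 := by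
      have : (k : ℝ) < (n + 2 : ℕ) := by
        push_cast
        nlinarith [u.2.2]
      exact_mod_cast this
    have hdiv : (k : ℝ) / ((n : ℝ) + 1) ≤ u := by rw [div_le_iff₀ hn0]; linarith
    have hck : (c k : ℝ) = (k : ℝ) / ((n : ℝ) + 1) := by
      simp only [hc]
      rw [Set.projIcc_of_mem zero_le_one ⟨by positivity, hdiv.trans u.2.2⟩]
    have hsum : ∑ l ∈ Finset.range (n + 2), (if k = l then (1 : ℝ) else 0) * h (c l) v =
        h (c k) v := by
      simp [hkn]
    rw [hsum]
    have hdist : dist (u, v) (c k, v) < δ := by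
      rw [Prod.dist_eq, dist_self, max_eq_left dist_nonneg, Subtype.dist_eq, Real.dist_eq, hck,
        abs_of_nonneg (sub_nonneg.2 hdiv)]
      refine lt_of_le_of_lt ?_ hn
      rw [sub_le_iff_le_add, ← add_div, le_div_iff₀ hn0]
      linarith
    have := hδh hdist
    rw [Real.dist_eq] at this
    exact this.le

lemma measurable_comp_prod {h : unitInterval → unitInterval → ℝ}
    (h_cont : Continuous fun p : unitInterval × unitInterval => h p.1 p.2)
    {F : ℝ → unitInterval} (hF : Measurable F) :
    Measurable fun p : ℝ × ℝ => h (F p.1) (F p.2) :=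
  h_cont.measurable.comp ((hF.comp measurable_fst).prodMk (hF.comp measurable_snd))

/-- A sequence converges if it is uniformly approximated by convergent sequences whose limits
approximate the prospective limit. -/
lemma tendsto_of_approx {a : ℕ → ℝ} {L : ℝ} {b : ℕ → ℕ → ℝ} {c : ℕ → ℝ}
    (hb : ∀ k, Tendsto (b k) atTop (𝓝 (c k))) (hab : ∀ k m, |a m - b k m| ≤ 1 / ((k : ℝ) + 1))
    (hcL : ∀ k, |c k - L| ≤ 1 / ((k : ℝ) + 1)) : Tendsto a atTop (𝓝 L) := by
  rw [Metric.tendsto_atTop]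
  intro ε hε
  obtain ⟨k, hk⟩ := exists_nat_one_div_lt (show 0 < ε / 3 by positivity)
  obtain ⟨M, hM⟩ := (Metric.tendsto_atTop.1 (hb k)) (ε / 3) (by positivity)
  refine ⟨M, fun m hm => ?_⟩
  have h1 := hM m hm
  have h2 := hab k m
  have h3 := hcL k
  rw [Real.dist_eq] at h1 ⊢
  rw [abs_lt] at h1 ⊢
  rw [abs_le] at h2 h3
  constructor <;> linarith

/-- Almost sure convergence of averages of `k (s, t)` over pairs of points extends from products
`k (s, t) = f s * g t` to the kernels `h (F s) (F t)` with `h` continuous. -/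
lemma ae_tendsto_of_mul {Ω : Type*} [MeasurableSpace Ω] {P : Measure Ω} {ι : ℕ → Type*}
    [∀ m, Fintype (ι m)] (s t : ∀ m, Ω → ι m → ℝ) {D : ℕ → ℝ}
    (hD : ∀ m, (Fintype.card (ι m) : ℝ) ≤ D m) {Θ : Measure (ℝ × ℝ)} [IsProbabilityMeasure Θ]
    (H : ∀ (f g : ℝ → ℝ) (C : ℝ), Measurable f → Measurable g → (∀ y, |f y| ≤ C) →
      (∀ y, |g y| ≤ C) → ∀ᵐ ω ∂P, Tendsto (fun m => (∑ q, f (s m ω q) * g (t m ω q)) / D m) atTop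
        (𝓝 (∫ p, f p.1 * g p.2 ∂Θ)))
    {h : unitInterval → unitInterval → ℝ}
    (h_cont : Continuous fun p : unitInterval × unitInterval => h p.1 p.2)
    {F : ℝ → unitInterval} (hF : Measurable F) :
    ∀ᵐ ω ∂P, Tendsto (fun m => (∑ q, h (F (s m ω q)) (F (t m ω q))) / D m) atTop
      (𝓝 (∫ p, h (F p.1) (F p.2) ∂Θ)) := by
  choose N f g C hf hg hfC hgC hfg using fun k : ℕ =>
    exists_sum_mul_approx h_cont (ε := 1 / ((k : ℝ) + 1)) (by positivity)
  have hint : ∀ k l, Integrable (fun p : ℝ × ℝ => f k l (F p.1) * g k l (F p.2)) Θ := fun k l => by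
    refine integrable_of_abs_le (C := C k * C k) (((hf k l).comp (hF.comp measurable_fst)).mul
      ((hg k l).comp (hF.comp measurable_snd))) fun p => ?_
    rw [abs_mul]
    exact mul_le_mul (hfC k l _) (hgC k l _) (abs_nonneg _) ((abs_nonneg _).trans (hfC k l 0))
  obtain ⟨C', hC'⟩ := exists_abs_le_of_continuous h_cont
  have hhint : Integrable (fun p : ℝ × ℝ => h (F p.1) (F p.2)) Θ :=
    integrable_of_abs_le (measurable_comp_prod h_cont hF) fun p => hC' _ _
  have hall : ∀ᵐ ω ∂P, ∀ k l, Tendsto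
      (fun m => (∑ q, f k l (F (s m ω q)) * g k l (F (t m ω q))) / D m) atTop
      (𝓝 (∫ p, f k l (F p.1) * g k l (F p.2) ∂Θ)) :=
    ae_all_iff.2 fun k => ae_all_iff.2 fun l =>
      H (fun y => f k l (F y)) (fun y => g k l (F y)) (C k) ((hf k l).comp hF) ((hg k l).comp hF)
      (fun y => hfC k l _) fun y => hgC k l _
  filter_upwards [hall] with ω hω
  refine tendsto_of_approx (b := fun k m => ∑ l ∈ Finset.range (N k),
    (∑ q, f k l (F (s m ω q)) * g k l (F (t m ω q))) / D m)
    (fun k => tendsto_finsetSum (Finset.range (N k)) fun l _ => hω k l) (fun k m => ?_) fun k => ?_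
  · have hD0 : 0 ≤ D m := (Nat.cast_nonneg _).trans (hD m)
    rw [← Finset.sum_div, Finset.sum_comm, ← sub_div, ← Finset.sum_sub_distrib, abs_div,
      abs_of_nonneg hD0]
    refine div_le_of_le_mul₀ hD0 (by positivity) ((Finset.abs_sum_le_sum_abs _ _).trans ?_)
    refine (Finset.sum_le_card_nsmul _ _ _ fun q _ => hfg k _ _).trans ?_
    rw [nsmul_eq_mul, mul_comm, Finset.card_univ]
    exact mul_le_mul_of_nonneg_left (hD m) (by positivity)
  · rw [← integral_finsetSum _ fun l _ => hint k l,
      ← integral_sub (integrable_finsetSum _ fun l _ => hint k l) hhint]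
    have := norm_integral_le_of_norm_le_const (μ := Θ)
      (f := fun p : ℝ × ℝ => ∑ l ∈ Finset.range (N k), f k l (F p.1) * g k l (F p.2) -
        h (F p.1) (F p.2)) (C := 1 / ((k : ℝ) + 1))
      (ae_of_all _ fun p => by rw [Real.norm_eq_abs, abs_sub_comm]; exact hfg k _ _)
    simpa using this

end Approximation

/-! ### The two statistics and their limits -/

section Limits

/-- The law of a pair `(Y, Y')` which is conditionally independent given `X ∼ μ`, both components
having conditional law `κ X`. -/
noncomputable def conditionalPairLaw (μ : Measure ℝ) (κ : Kernel ℝ ℝ) : Measure (ℝ × ℝ) :=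
  (μ ⊗ₘ (κ ×ₖ κ)).map Prod.snd

instance (μ : Measure ℝ) [IsProbabilityMeasure μ] (κ : Kernel ℝ ℝ) [IsMarkovKernel κ] :
    IsProbabilityMeasure (conditionalPairLaw μ κ) :=
  Measure.isProbabilityMeasure_map measurable_snd.aemeasurable

lemma integral_conditionalPairLaw (μ : Measure ℝ) [IsProbabilityMeasure μ] (κ : Kernel ℝ ℝ)
    [IsMarkovKernel κ] {G : ℝ × ℝ → ℝ} (hG : Measurable G) {C : ℝ} (hC : ∀ p, |G p| ≤ C) :
    ∫ p, G p ∂conditionalPairLaw μ κ = ∫ x, ∫ z, ∫ y, G (y, z) ∂κ x ∂κ x ∂μ := by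
  rw [conditionalPairLaw, integral_map measurable_snd.aemeasurable hG.aestronglyMeasurable,
    Measure.integral_compProd (f := fun q : ℝ × ℝ × ℝ => G q.2)
      (integrable_of_abs_le (hG.comp measurable_snd) fun p => hC _)]
  refine integral_congr_ae (ae_of_all _ fun x => ?_)
  simp only [Kernel.prod_apply]
  exact integral_prod_symm _ (integrable_of_abs_le hG hC)

variable {Ω : Type*} [MeasurableSpace Ω] {P : Measure Ω} {Xs Ys : ℕ → Ω → ℝ}
  {h : unitInterval → unitInterval → ℝ} {F : ℝ → unitInterval}

lemma IsIIDSample.ae_tendsto_normStat {ρ : Measure (ℝ × ℝ)} [IsProbabilityMeasure ρ]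
    (hS : IsIIDSample P Xs Ys ρ)
    (h_cont : Continuous fun p : unitInterval × unitInterval => h p.1 p.2) (hF : Measurable F) :
    ∀ᵐ ω ∂P, Tendsto (fun n : ℕ => normStat h F (fun i : Fin n => Ys i ω)) atTop
      (𝓝 (∫ p, h (F p.1) (F p.2) ∂(ρ.map Prod.snd).prod (ρ.map Prod.snd))) := by
  have : IsProbabilityMeasure (ρ.map Prod.snd) :=
    Measure.isProbabilityMeasure_map measurable_snd.aemeasurable
  have key := ae_tendsto_of_mul (P := P) (ι := fun n => Fin n × Fin n)
    (fun n ω q => Ys q.1 ω) (fun n ω q => Ys q.2 ω)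
    (D := fun n => (n : ℝ) ^ 2) (fun n => by simp [sq])
    (Θ := (ρ.map Prod.snd).prod (ρ.map Prod.snd))
    (fun f g C hf hg hfC hgC => by
      have hmean : ∀ f : ℝ → ℝ, Measurable f → (∀ y, |f y| ≤ C) → ∀ᵐ ω ∂P, Tendsto
          (fun n : ℕ => (∑ i : Fin n, f (Ys i ω)) / (n : ℝ)) atTop
          (𝓝 (∫ y, f y ∂ρ.map Prod.snd)) := fun f hf hfC => by
        rw [integral_map measurable_snd.aemeasurable hf.aestronglyMeasurable]
        exact hS.ae_tendsto_mean (hf.comp measurable_snd)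
          (integrable_of_abs_le (hf.comp measurable_snd) fun z => hfC _)
      rw [integral_prod_mul]
      filter_upwards [hmean f hf hfC, hmean g hg hgC] with ω hω1 hω2
      refine (hω1.mul hω2).congr fun n => ?_
      rw [div_mul_div_comm, ← sq, Finset.sum_mul_sum, Fintype.sum_prod_type]) h_cont hF
  filter_upwards [key] with ω hω
  refine hω.congr fun n => ?_
  rw [normStat, Fintype.sum_prod_type, div_eq_inv_mul, one_div]

variable [IsProbabilityMeasure P]

lemma IsIIDSample.ae_tendsto_variationStat {μ : Measure ℝ} [IsProbabilityMeasure μ]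
    {κ : Kernel ℝ ℝ} [IsMarkovKernel κ] {π : (n : ℕ) → Ω → Equiv.Perm (Fin n)}
    (hS : IsIIDSample P Xs Ys (μ ⊗ₘ κ))
    (hπ : ∀ n, IsUniformOrdering P (fun i : Fin n => Xs i) (fun i : Fin n => Ys i) (π n))
    (h_cont : Continuous fun p : unitInterval × unitInterval => h p.1 p.2) (hF : Measurable F) :
    ∀ᵐ ω ∂P, Tendsto (fun n : ℕ => variationStat h F (fun i : Fin n => Ys i ω) (π n ω)) atTop
      (𝓝 (∫ p, h (F p.1) (F p.2) ∂conditionalPairLaw μ κ)) := by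
  have key := ae_tendsto_of_mul (P := P) (ι := Fin)
    (fun m ω i => Ys (π (m + 1) ω i.castSucc) ω) (fun m ω i => Ys (π (m + 1) ω i.succ) ω)
    (D := fun m => (m : ℝ) + 1) (fun m => by simp) (Θ := conditionalPairLaw μ κ)
    (fun f g C hf hg hfC hgC => by
      have hlim : ∫ p, f p.1 * g p.2 ∂conditionalPairLaw μ κ =
          ∫ x, (∫ y, f y ∂κ x) * (∫ y, g y ∂κ x) ∂μ := by
        rw [integral_conditionalPairLaw μ κ (G := fun p => f p.1 * g p.2) (C := C * C)
          ((hf.comp measurable_fst).mul (hg.comp measurable_snd)) fun p => by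
            rw [abs_mul]
            exact mul_le_mul (hfC _) (hgC _) (abs_nonneg _) ((abs_nonneg _).trans (hfC 0))]
        simp only [integral_mul_const, integral_const_mul]
      rw [hlim]
      exact hS.ae_tendsto_variation_mul hπ hf hg hfC hgC) h_cont hF
  filter_upwards [key] with ω hω
  refine (tendsto_add_atTop_iff_nat 1).1 (hω.congr fun m => ?_)
  simp only [variationStat, Nat.cast_add, Nat.cast_one]
  rw [div_eq_inv_mul, one_div]
  rfl

/-- If the limit of `normStat` vanishes then so does `normStat`, as all the `h (F Yᵢ) (F Yⱼ)` are
zero: those with `i ≠ j` because their expectation is the limit, the others because `h` is zero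
on the diagonal. -/
lemma IsIIDSample.ae_normStat_eq_zero {ρ : Measure (ℝ × ℝ)} [IsProbabilityMeasure ρ]
    (hS : IsIIDSample P Xs Ys ρ)
    (h_cont : Continuous fun p : unitInterval × unitInterval => h p.1 p.2) (hF : Measurable F)
    (h_nonneg : ∀ u v, 0 ≤ h u v) (h_diag : ∀ u, h u u = 0)
    (h0 : ∫ p, h (F p.1) (F p.2) ∂(ρ.map Prod.snd).prod (ρ.map Prod.snd) = 0) :
    ∀ᵐ ω ∂P, ∀ n : ℕ, normStat h F (fun i : Fin n => Ys i ω) = 0 := by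
  have : IsProbabilityMeasure (ρ.map Prod.snd) :=
    Measure.isProbabilityMeasure_map measurable_snd.aemeasurable
  obtain ⟨C, hC⟩ := exists_abs_le_of_continuous h_cont
  have hm := measurable_comp_prod h_cont hF
  rw [integral_eq_zero_iff_of_nonneg (fun p => h_nonneg _ _)
    (integrable_of_abs_le hm fun p => hC _ _)] at h0
  have hlaw : ∀ i, P.map (Ys i) = ρ.map Prod.snd := fun i => by
    rw [← hS.map_eq i, Measure.map_map measurable_snd (hS.measurable i)]
    rfl
  have hpair : ∀ i j, ∀ᵐ ω ∂P, h (F (Ys i ω)) (F (Ys j ω)) = 0 := fun i j => by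
    by_cases hij : i = j
    · subst hij
      exact ae_of_all _ fun ω => h_diag _
    · have hind : IndepFun (Ys i) (Ys j) P :=
        (hS.indep.indepFun hij).comp measurable_snd measurable_snd
      have hmap := (indepFun_iff_map_prod_eq_prod_map_map (hS.measurable_right i).aemeasurable
        (hS.measurable_right j).aemeasurable).1 hind
      rw [hlaw, hlaw] at hmap
      rw [← hmap] at h0
      exact ae_of_ae_map
        ((hS.measurable_right i).prodMk (hS.measurable_right j)).aemeasurable h0
  filter_upwards [ae_all_iff.2 fun i => ae_all_iff.2 (hpair i)] with ω hω n
  simp [normStat, hω]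

end Limits

end CorrCoef

theorem theorem1 {Ω : Type*} [MeasurableSpace Ω] (P : Measure Ω) [IsProbabilityMeasure P]
    (h : unitInterval → unitInterval → ℝ)
    (h_cont : Continuous fun p : unitInterval × unitInterval => h p.1 p.2)
    (h_nonneg : ∀ u v, 0 ≤ h u v) (h_diag : ∀ u, h u u = 0)
    (F : ℝ → unitInterval) (hF : CorrCoef.IsCDF F)
    -- the pair `(X, Y)`, neither component of which is (a.s.) constant
    (X Y : Ω → ℝ) (hX : Measurable X) (hY : Measurable Y)
    (hX_nonconst : ¬ ∃ c : ℝ, X =ᵐ[P] fun _ => c)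
    (hY_nonconst : ¬ ∃ c : ℝ, Y =ᵐ[P] fun _ => c)
    -- the i.i.d. samples of `(X, Y)`
    (Xs Ys : ℕ → Ω → ℝ) (hXs : ∀ i, Measurable (Xs i)) (hYs : ∀ i, Measurable (Ys i))
    (h_indep : iIndepFun (fun i ω => (Xs i ω, Ys i ω)) P)
    (h_ident : ∀ i, IdentDistrib (fun ω => (Xs i ω, Ys i ω)) (fun ω => (X ω, Y ω)) P P)
    -- for each `n`, the ordering of the first `n` samples by the `X`-value, ties broken at random
    (π : (n : ℕ) → Ω → Equiv.Perm (Fin n))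
    (hπ : ∀ n, CorrCoef.IsUniformOrdering P (fun i : Fin n => Xs i) (fun i : Fin n => Ys i) (π n)) :
    (∀ᵐ ω ∂P, Tendsto
        (fun n : ℕ => CorrCoef.variationStat h F (fun i : Fin n => Ys i ω) (π n ω)) atTop
        (𝓝 (CorrCoef.variationLimit h F P X Y))) ∧
    (∀ᵐ ω ∂P, Tendsto
        (fun n : ℕ => CorrCoef.normStat h F (fun i : Fin n => Ys i ω)) atTop
        (𝓝 (CorrCoef.normLimit h F P Y))) ∧
    (∀ᵐ ω ∂P, Tendsto
        (fun n : ℕ => CorrCoef.corrCoef h F (fun i : Fin n => Ys i ω) (π n ω)) atTop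
        (𝓝 (CorrCoef.corrMeasure h F P X Y))) := by
  have hFm := hF.measurable
  obtain ⟨C, hC⟩ := CorrCoef.exists_abs_le_of_continuous h_cont
  have hhm := CorrCoef.measurable_comp_prod h_cont hFm
  have : IsProbabilityMeasure (P.map X) := Measure.isProbabilityMeasure_map hX.aemeasurable
  have : IsProbabilityMeasure (P.map Y) := Measure.isProbabilityMeasure_map hY.aemeasurable
  have hρ : P.map X ⊗ₘ condDistrib Y X P = P.map fun ω => (X ω, Y ω) :=
    compProd_map_condDistrib hY.aemeasurable
  have hS : CorrCoef.IsIIDSample P Xs Ys (P.map X ⊗ₘ condDistrib Y X P) :=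
    ⟨hXs, hYs, h_indep, fun i => by rw [(h_ident i).map_eq, hρ]⟩
  have hsnd : (P.map X ⊗ₘ condDistrib Y X P).map Prod.snd = P.map Y := by
    rw [hρ, Measure.map_map measurable_snd (hX.prodMk hY)]
    rfl
  have hζ : ∫ p, h (F p.1) (F p.2) ∂CorrCoef.conditionalPairLaw (P.map X) (condDistrib Y X P) =
      CorrCoef.variationLimit h F P X Y :=
    CorrCoef.integral_conditionalPairLaw _ _ hhm fun p => hC _ _
  have hχ : ∫ p, h (F p.1) (F p.2) ∂(P.map Y).prod (P.map Y) = CorrCoef.normLimit h F P Y :=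
    integral_prod_symm _ (CorrCoef.integrable_of_abs_le hhm fun p => hC _ _)
  have h1 := hS.ae_tendsto_variationStat hπ h_cont hFm
  have h2 := hS.ae_tendsto_normStat h_cont hFm
  have h3 := hS.ae_normStat_eq_zero h_cont hFm h_nonneg h_diag
  rw [hζ] at h1
  rw [hsnd, hχ] at h2 h3
  refine ⟨h1, h2, ?_⟩
  by_cases h0 : CorrCoef.normLimit h F P Y = 0
  · filter_upwards [h3 h0] with ω hω
    simp [CorrCoef.corrCoef, CorrCoef.corrMeasure, hω, h0]
  · filter_upwards [h1, h2] with ω hω1 hω2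
    have hlim : Tendsto (fun n : ℕ => 1 - CorrCoef.variationStat h F (fun i : Fin n => Ys i ω)
        (π n ω) / CorrCoef.normStat h F (fun i : Fin n => Ys i ω)) atTop
        (𝓝 (CorrCoef.corrMeasure h F P X Y)) := by
      rw [CorrCoef.corrMeasure, if_neg h0]
      exact tendsto_const_nhds.sub (hω1.div hω2 h0)
    refine hlim.congr' ?_
    filter_upwards [hω2.eventually_ne h0] with n hn
    rw [CorrCoef.corrCoef, if_neg hn]
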